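/- Let $p$ be a prime and $S$ a finite $p$-group. Definitions. A *fusion system* $\mathcal F$ on $S$ is a category whose objects are the subgroups of $S$, with $\operatorname{Hom}_S(P,Q)\subseteq\operatorname{Hom}_{\mathcal F}(P,Q)\subseteq\operatorname{Inj}(P,Q)$ for all $P,Q\le S$ (where $\operatorname{Hom}_S(P,Q)$ consists of the maps induced by conjugation by elements of $S$ and $\operatorname{Inj}(P,Q)$ of the injective homomorphisms), and in which every morphism is an $\mathcal F$-isomorphism onto its image followed by an inclusion. Write $P^{\mathcal F}$ for the set of images of $P$ under morphisms in $\operatorname{Hom}_{\mathcal F}(P,S)$, and $\operatorname{Aut}_S(P)\le\operatorname{Aut}_{\mathcal F}(P)$ for the automorphisms of $P$ induced by $N_S(P)$, respectively lying in $\mathcal F$. * $P$ is *$S$-centric* if $C_S(P)=Z(P)$, and *$\mathcal F$-centric* if every $Q\in P^{\mathcal F}$ is $S$-centric; $P$ is *fully $\mathcal F$-normalized* if $|N_S(P)|\ge|N_S(Q)|$ for all $Q\in P^{\mathcal F}$; $P$ is *fully $\mathcal F$-automized* if $\operatorname{Aut}_S(P)\in\operatorname{Syl}_p(\operatorname{Aut}_{\mathcal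 F}(P))$. * $Q$ is *$\mathcal F$-receptive* if every $\mathcal F$-isomorphism $\alpha\colon P\to Q$ extends to a morphism in $\operatorname{Hom}_{\mathcal F}(N_\alpha,S)$, where $N_\alpha=\{g\in N_S(P)\mid \alpha c_g\alpha^{-1}\in\operatorname{Aut}_S(Q)\}$, $c_g$ being the conjugation map of $g$ on $P$. $\mathcal F$ is *saturated* if for every $P\le S$ some $Q\in P^{\mathcal F}$ is fully $\mathcal F$-automized and $\mathcal F$-receptive. * A subgroup $M<H$ of a finite group $H$ is *strongly $p$-embedded* if $p$ divides $|M|$ and $p\nmid|M\cap hMh^{-1}|$ for all $h\in H\setminus M$. $P$ is *$\mathcal F$-essential* if $P<S$, $P$ is $\mathcal F$-centric and fully $\mathcal F$-normalized, and $\operatorname{Aut}_{\mathcal F}(P)/\operatorname{Inn}(P)$ has a strongly $p$-embedded subgroup. * A *fusion datum* on $S$ is a pair $\mathcal D=(\mathcal Q,\mathcal A)$, where $\mathcal Q$ is a finite sequence of $S$-centric subgroups of $S$ with first element $S$, $\mathcal A$ assigns to each $Q\in\mathcal Q$ a subgroup $\mathcal A(Q)\le\operatorname{Aut}(Q)$ containing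 $\operatorname{Aut}_S(Q)$, and no two members of $\mathcal Q$ are in the same $\mathcal A(S)$-orbit. $\mathcal F(\mathcal D)$ is the smallest fusion system on $S$ containing $\mathcal A(Q)$ for every $Q\in\mathcal Q$. * $\mathcal D$ is an *automizer sequence* if, with $\mathcal F=\mathcal F(\mathcal D)$, for each $Q\in\mathcal Q$: $\mathcal A(Q)=\operatorname{Aut}_{\mathcal F}(Q)$; $Q$ is $\mathcal F$-centric; $\operatorname{Aut}_S(Q)\in\operatorname{Syl}_p(\mathcal A(Q))$; and, if $Q\ne S$, $\mathcal A(Q)/\operatorname{Inn}(Q)$ has a strongly $p$-embedded subgroup. * $\mathcal D$ is an *Alperin sequence associated to* a saturated fusion system $\mathcal F$ on $S$ if every member of $\mathcal Q$ is $S$ or $\mathcal F$-essential, every $\mathcal F$-conjugacy class that contains an $\mathcal F$-essential subgroup has an $\mathcal F$-essential representative in $\mathcal Q$, and $\mathcal A(Q)=\operatorname{Aut}_{\mathcal F}(Q)$ for each $Q\in\mathcal Q$. Proposition. Let $\mathcal D$ be a fusion datum on $S$. 1. If $\mathcal D$ is an automizer sequence and $\mathcal F(\mathcal D)$ is saturated,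 then $\mathcal D$ is an Alperin sequence associated to $\mathcal F(\mathcal D)$. 2. Conversely, if $\mathcal D$ is an Alperin sequence associated to a saturated fusion system $\mathcal F$ on $S$, then $\mathcal D$ is an automizer sequence and $\mathcal F=\mathcal F(\mathcal D)$. -/

import Mathlib

namespace Fusion

variable {S : Type*} [Group S]

/-! Maps are written on the left, and the conjugation map of `g` is `x ↦ g * x * g⁻¹`. -/

/-- The image, as a subgroup of `S`, of a homomorphism between subgroups of `S`. -/
def image {P Q : Subgroup S} (φ : P →* Q) : Subgroup S :=
  (Q.subtype.comp φ).range

/-- `Hom_S(P, Q)`: the homomorphisms `P → Q` induced by conjugation by an element of `S`. -/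
def homS (P Q : Subgroup S) : Set (P →* Q) :=
  {φ | ∃ g : S, ∀ x : P, (φ x : S) = g * x * g⁻¹}

/-- A fusion system on `S`: a category whose objects are the subgroups of `S`, with
`Hom_S(P, Q) ⊆ Hom(P, Q) ⊆ Inj(P, Q)` and with the usual composition (identities and inclusions
belong to `Hom_S`), in which every morphism is an isomorphism of the category onto its image
followed by the inclusion of the image. -/
@[ext]
structure FusionSystem (S : Type*) [Group S] where
  hom : (P Q : Subgroup S) → Set (P →* Q)
  comp_mem : ∀ {P Q R : Subgroup S} {φ : P →* Q} {ψ : Q →* R},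
    φ ∈ hom P Q → ψ ∈ hom Q R → ψ.comp φ ∈ hom P R
  homS_subset : ∀ P Q : Subgroup S, homS P Q ⊆ hom P Q
  injective : ∀ {P Q : Subgroup S} {φ : P →* Q}, φ ∈ hom P Q → Function.Injective φ
  factor : ∀ {P Q : Subgroup S} {φ : P →* Q}, φ ∈ hom P Q →
    ∃ e : P ≃* image φ, (∀ x : P, (e x : S) = φ x) ∧
      e.toMonoidHom ∈ hom P (image φ) ∧ e.symm.toMonoidHom ∈ hom (image φ) P

/-- `Aut_S(P)`: the automorphisms of `P` induced by conjugation by elements of `N_S(P)`. -/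
def autS (P : Subgroup S) : Subgroup (MulAut P) :=
  P.normalizerMonoidHom.range

/-- `Inn(G)`. -/
def inn (G : Type*) [Group G] : Subgroup (MulAut G) :=
  (MulAut.conj : G →* MulAut G).range

instance inn_normal (G : Type*) [Group G] : (inn G).Normal := by
  refine ⟨?_⟩
  rintro _ ⟨g, rfl⟩ a
  refine ⟨a g, ?_⟩
  ext x
  simp [MulAut.mul_apply]

/-- `A / Inn(G)` for a group of automorphisms `A` of `G` (used when `Inn(G) ≤ A`). -/
abbrev Out {G : Type*} [Group G] (A : Subgroup (MulAut G)) : Type _ :=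
  A ⧸ (inn G).subgroupOf A

/-- `T` is a Sylow `p`-subgroup of the subgroup `A`. -/
def IsSylowOf (p : ℕ) {G : Type*} [Group G] (T A : Subgroup G) : Prop :=
  ∃ U : Sylow p A, (U : Subgroup A).map A.subtype = T

/-- The (finite) group `H` has a strongly `p`-embedded subgroup: a proper subgroup `M` of order
divisible by `p` such that `M ∩ hMh⁻¹` has order prime to `p` for all `h ∉ M`. -/
def HasStronglyEmbedded (p : ℕ) (H : Type*) [Group H] : Prop :=
  ∃ M : Subgroup H, M ≠ ⊤ ∧ p ∣ Nat.card M ∧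
    ∀ h : H, h ∉ M → ¬ p ∣ Nat.card (M ⊓ M.map (MulAut.conj h).toMonoidHom : Subgroup H)

/-- `P` is `S`-centric: `C_S(P) = Z(P)`. -/
def IsCentricIn (P : Subgroup S) : Prop :=
  Subgroup.centralizer (P : Set S) = (Subgroup.center P).map P.subtype

/-- The extension control subgroup `N_α` of an isomorphism `α : P → Q`: the elements `g` of
`N_S(P)` for which `α ∘ c_g ∘ α⁻¹` lies in `Aut_S(Q)`. -/
def extControl {P Q : Subgroup S} (α : P ≃* Q) : Subgroup S :=
  ((autS Q).comap ((MulAut.congr α).toMonoidHom.comp P.normalizerMonoidHom)).map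
    (Subgroup.normalizer (P : Set S)).subtype

theorem le_extControl {P Q : Subgroup S} (α : P ≃* Q) : P ≤ extControl α := by
  intro x hx
  refine ⟨⟨x, Subgroup.le_normalizer hx⟩, ?_, rfl⟩
  refine ⟨⟨α ⟨x, hx⟩, Subgroup.le_normalizer (α ⟨x, hx⟩).2⟩, ?_⟩
  ext y
  have h : P.normalizerMonoidHom ⟨x, Subgroup.le_normalizer hx⟩ (α.symm y)
      = ⟨x, hx⟩ * α.symm y * ⟨x, hx⟩⁻¹ := rfl
  have h' : (MulAut.congr α) (P.normalizerMonoidHom ⟨x, Subgroup.le_normalizer hx⟩) y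
      = α (P.normalizerMonoidHom ⟨x, Subgroup.le_normalizer hx⟩ (α.symm y)) := rfl
  change ((α ⟨x, hx⟩ : S) * y * (α ⟨x, hx⟩ : S)⁻¹) =
    ((MulAut.congr α) (P.normalizerMonoidHom ⟨x, Subgroup.le_normalizer hx⟩) y : Q)
  rw [h', h]
  simp

namespace FusionSystem

theorem refl_mem (F : FusionSystem S) (P : Subgroup S) : MonoidHom.id P ∈ F.hom P P :=
  F.homS_subset P P ⟨1, fun x => by simp⟩

theorem symm_mem (F : FusionSystem S) {P : Subgroup S} {a : MulAut P}
    (ha : a.toMonoidHom ∈ F.hom P P) : a.symm.toMonoidHom ∈ F.hom P P := by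
  obtain ⟨e, he, -, hs⟩ := F.factor ha
  have hle : P ≤ image a.toMonoidHom := by
    intro x hx
    refine ⟨a.symm ⟨x, hx⟩, ?_⟩
    simp
  have hi : Subgroup.inclusion hle ∈ F.hom P (image a.toMonoidHom) :=
    F.homS_subset _ _ ⟨1, fun x => by simp; rfl⟩
  have hc := F.comp_mem hi hs
  convert hc using 1
  ext x
  have : a (e.symm (Subgroup.inclusion hle x)) = x := by
    apply Subtype.ext
    have := he (e.symm (Subgroup.inclusion hle x))
    rw [MulEquiv.apply_symm_apply] at this
    exact this.symm
  have h2 : a.symm x = e.symm (Subgroup.inclusion hle x) := by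
    rw [MulEquiv.symm_apply_eq]; exact this.symm
  exact congrArg Subtype.val h2

/-- `Aut_F(P)`. -/
def aut (F : FusionSystem S) (P : Subgroup S) : Subgroup (MulAut P) where
  carrier := {a | a.toMonoidHom ∈ F.hom P P}
  one_mem' := F.refl_mem P
  mul_mem' := fun ha hb => F.comp_mem hb ha
  inv_mem' := fun ha => F.symm_mem ha

/-- `Q` belongs to the `F`-conjugacy class `P^F` of `P`. -/
def Conj (F : FusionSystem S) (P Q : Subgroup S) : Prop :=
  ∃ φ ∈ F.hom P ⊤, image φ = Q

/-- `|N_S(P)| ≥ |N_S(Q)|` for all `Q ∈ P^F`. -/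
def IsFullyNormalized (F : FusionSystem S) (P : Subgroup S) : Prop :=
  ∀ Q, F.Conj P Q →
    Nat.card (Subgroup.normalizer (Q : Set S)) ≤ Nat.card (Subgroup.normalizer (P : Set S))

/-- `Aut_S(P)` is a Sylow `p`-subgroup of `Aut_F(P)`. -/
def IsFullyAutomized (p : ℕ) (F : FusionSystem S) (P : Subgroup S) : Prop :=
  IsSylowOf p (autS P) (F.aut P)

/-- Every member of `P^F` is `S`-centric. -/
def IsCentric (F : FusionSystem S) (P : Subgroup S) : Prop :=
  ∀ Q, F.Conj P Q → IsCentricIn Q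

/-- `P` is `F`-essential. -/
structure IsEssential (p : ℕ) (F : FusionSystem S) (P : Subgroup S) : Prop where
  lt_top : P < ⊤
  centric : F.IsCentric P
  fullyNormalized : F.IsFullyNormalized P
  stronglyEmbedded : HasStronglyEmbedded p (Out (F.aut P))

/-- Every `F`-isomorphism `α : P → Q` extends to a morphism `N_α → S` of `F`. -/
def IsReceptive (F : FusionSystem S) (Q : Subgroup S) : Prop :=
  ∀ (P : Subgroup S) (α : P ≃* Q), α.toMonoidHom ∈ F.hom P Q →
    ∃ β ∈ F.hom (extControl α) ⊤,
      ∀ x : P, (β (Subgroup.inclusion (le_extControl α) x) : S) = α x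

/-- Every subgroup of `S` is `F`-conjugate to one that is fully `F`-automized and `F`-receptive. -/
def IsSaturated (p : ℕ) (F : FusionSystem S) : Prop :=
  ∀ P : Subgroup S, ∃ Q, F.Conj P Q ∧ F.IsFullyAutomized p Q ∧ F.IsReceptive Q

/-- The universal fusion system, consisting of all injective homomorphisms. -/
def universal (S : Type*) [Group S] : FusionSystem S where
  hom P Q := {φ | Function.Injective φ}
  comp_mem := fun h₁ h₂ => h₂.comp h₁
  homS_subset := by
    rintro P Q φ ⟨g, hg⟩ x y hxy
    have h : (φ x : S) = φ y := by rw [hxy]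
    rw [hg, hg] at h
    exact Subtype.ext (by simpa using h)
  injective := fun h => h
  factor := by
    intro P Q φ h
    have h' : Function.Injective (Q.subtype.comp φ) := Q.subtype_injective.comp h
    exact ⟨MonoidHom.ofInjective h', fun x => rfl, MulEquiv.injective _, MulEquiv.injective _⟩

/-- `⟨X⟩` for a family `X` of sets of automorphisms of subgroups of `S`: the smallest fusion
system on `S` containing them, that is, the intersection of all fusion systems containing them. -/
def generate (X : (P : Subgroup S) → Set (MulAut P)) : FusionSystem S where
  hom P Q := {φ | ∀ G : FusionSystem S,
    (∀ R : Subgroup S, ∀ a ∈ X R, a.toMonoidHom ∈ G.hom R R) → φ ∈ G.hom P Q}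
  comp_mem := fun h₁ h₂ G hG => G.comp_mem (h₁ G hG) (h₂ G hG)
  homS_subset := fun P Q _ h G _ => G.homS_subset P Q h
  injective := fun h => h (universal S) fun _ a _ => a.injective
  factor := by
    intro P Q φ h
    obtain ⟨e, he, -, -⟩ :=
      (universal S).factor (h (universal S) fun _ a _ => a.injective)
    refine ⟨e, he, fun G hG => ?_, fun G hG => ?_⟩
    all_goals
      obtain ⟨e', he', h₁, h₂⟩ := G.factor (h G hG)
      obtain rfl : e = e' := by
        ext x
        rw [he, he']
      assumption

end FusionSystem

/-- A fusion datum on `S`: a finite sequence `seq` of `S`-centric subgroups of `S` with first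
element `S`, and for each member `Q` a group `A Q` of automorphisms of `Q` containing `Aut_S(Q)`,
such that no two members of the sequence are in the same `A(S)`-orbit. -/
structure FusionDatum (S : Type*) [Group S] where
  seq : List (Subgroup S)
  head_eq : seq.head? = some ⊤
  centric : ∀ Q ∈ seq, IsCentricIn Q
  A : (Q : Subgroup S) → Q ∈ seq → Subgroup (MulAut Q)
  autS_le : ∀ (Q : Subgroup S) (hQ : Q ∈ seq), autS Q ≤ A Q hQ
  orbit : seq.Pairwise fun P Q => ∀ a ∈ A ⊤ (List.mem_of_head? head_eq),
    ((P.subgroupOf ⊤).map a.toMonoidHom).map (⊤ : Subgroup S).subtype ≠ Q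

namespace FusionDatum

/-- `F(D)`: the smallest fusion system on `S` containing `A(Q)` for every member `Q`. -/
def fusionSystem (D : FusionDatum S) : FusionSystem S :=
  FusionSystem.generate fun Q => {a | ∃ hQ : Q ∈ D.seq, a ∈ D.A Q hQ}

/-- `D` is an automizer sequence on `S`. -/
structure IsAutomizerSeq (p : ℕ) (D : FusionDatum S) : Prop where
  A_eq : ∀ (Q : Subgroup S) (hQ : Q ∈ D.seq), D.A Q hQ = D.fusionSystem.aut Q
  isCentric : ∀ Q ∈ D.seq, D.fusionSystem.IsCentric Q
  sylow : ∀ (Q : Subgroup S) (hQ : Q ∈ D.seq), IsSylowOf p (autS Q) (D.A Q hQ)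
  stronglyEmbedded : ∀ (Q : Subgroup S) (hQ : Q ∈ D.seq), Q ≠ ⊤ →
    HasStronglyEmbedded p (Out (D.A Q hQ))

/-- `D` is an Alperin sequence associated to `F` (a notion for saturated `F`). -/
structure IsAlperinSeq (p : ℕ) (D : FusionDatum S) (F : FusionSystem S) : Prop where
  essential_or_top : ∀ Q ∈ D.seq, F.IsEssential p Q ∨ Q = ⊤
  exists_rep : ∀ E : Subgroup S, F.IsEssential p E →
    ∃ Q ∈ D.seq, F.IsEssential p Q ∧ F.Conj E Q
  A_eq : ∀ (Q : Subgroup S) (hQ : Q ∈ D.seq), D.A Q hQ = F.aut Q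

end FusionDatum

end Fusion

/-!
An essential subgroup `E` of the system `F` generated by groups `A(Q)` is conjugate to some `Q`.
Otherwise let `M < Aut_F(E)` be the preimage of a strongly `p`-embedded subgroup, containing
`Aut_S(E)`, and label each `F`-embedding `ψ` of `E` into `S` by the coset of `M` whose elements
conjugate into `Aut_S(E)` the `p`-group of automorphisms that `N_S(ψ(E))` induces on `E`. An
automorphism `φ` of `Q` preserves labels: if `ψ(E) < Q`, then `N_Q(ψ(E)) > ψ(E)` induces
non-inner automorphisms of `E` through both `ψ` and `φψ`, and `p`-subgroups with a common element
outside `Inn(E)` have the same label. Hence all of `F` preserves labels, that is, `Aut_F(E) ≤ M`,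
a contradiction.

Conversely, a saturated `F` lies in `G` as soon as `Aut_F(Q) ≤ Aut_G(Q)` for `Q = S` and for a
representative `Q` of each class of essential subgroups (Alperin): descending on the order of `P`,
one reduces to `Aut_F(Q)` for a fully automized receptive `Q`. An automorphism that extends to a
larger subgroup belongs to `G` by induction, so if `Aut_F(Q)` is not contained in `Aut_G(Q)`, then
`Q` is centric and `Aut_F(Q) ∩ Aut_G(Q)` is strongly `p`-embedded modulo `Inn(Q)`; thus `Q` is
essential.
-/

namespace Fusion

section StronglyEmbedded

variable {p : ℕ} [Fact p.Prime] {H : Type*} [Group H]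

theorem exists_conj_mem_sylow [Finite (Sylow p H)] (T : Sylow p H) {B : Subgroup H}
    (hB : IsPGroup p B) : ∃ h : H, ∀ b ∈ B, h * b * h⁻¹ ∈ T := by
  obtain ⟨V, hBV⟩ := hB.exists_le_sylow
  obtain ⟨h, rfl⟩ := MulAction.exists_smul_eq H V T
  exact ⟨h, fun b hb => Subgroup.smul_mem_pointwise_smul b (MulAut.conj h) _ (hBV hb)⟩

theorem orderOf_conj (h x : H) : orderOf (h * x * h⁻¹) = orderOf x :=
  (MulAut.conj h).orderOf_eq x

theorem ne_one_of_orderOf_eq {x : H} (hx : orderOf x = p) : x ≠ 1 :=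
  fun h => (Fact.out : p.Prime).one_lt.ne (by rw [← hx, h, orderOf_one])

theorem exists_conj_mem_sylow_of_orderOf_eq [Finite (Sylow p H)] (T : Sylow p H) {x : H}
    (hx : orderOf x = p) : ∃ h : H, h * x * h⁻¹ ∈ T := by
  obtain ⟨h, hh⟩ := exists_conj_mem_sylow T
    (IsPGroup.of_card (n := 1) (by rw [Nat.card_zpowers, hx, pow_one]))
  exact ⟨h, hh x (Subgroup.mem_zpowers x)⟩

theorem prime_dvd_card_iff_exists_orderOf_eq [Finite H] {K : Subgroup H} :
    p ∣ Nat.card K ↔ ∃ x ∈ K, orderOf x = p := by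
  constructor
  · intro hp
    obtain ⟨x, hx⟩ := exists_prime_orderOf_dvd_card' p hp
    exact ⟨x, x.2, by rwa [Subgroup.orderOf_coe]⟩
  · rintro ⟨x, hxK, rfl⟩
    exact K.orderOf_dvd_natCard hxK

theorem exists_pow_orderOf_eq_prime (hH : IsPGroup p H) {x : H} (hx : x ≠ 1) :
    ∃ k, orderOf (x ^ k) = p :=
  ⟨_, orderOf_pow_orderOf_div (hH.isOfFinOrder (Fact.out : p.Prime).ne_zero x).orderOf_pos.ne'
    (hH.dvd_orderOf hx)⟩

theorem exists_mem_center_orderOf_eq_prime [Finite H] [Nontrivial H] (hH : IsPGroup p H) :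
    ∃ z ∈ Subgroup.center H, orderOf z = p := by
  have := hH.center_nontrivial
  exact prime_dvd_card_iff_exists_orderOf_eq.mp
    ((hH.to_subgroup _).card_eq_or_dvd.resolve_left Finite.one_lt_card.ne')

/-- `M` contains every element that conjugates some element of `X` into `X`. For `X` the
nontrivial part of a Sylow `p`-subgroup this expresses strong `p`-embeddedness of `M` without
mentioning intersections of conjugates. -/
def ContainsConjugators (M : Subgroup H) (X : Set H) : Prop :=
  ∀ ⦃h x : H⦄, x ∈ X → h * x * h⁻¹ ∈ X → h ∈ M

namespace ContainsConjugators

variable {M : Subgroup H} {X : Set H}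

theorem mono {Y : Set H} (h : ContainsConjugators M Y) (hXY : X ⊆ Y) : ContainsConjugators M X :=
  fun _ _ hx hgx => h (hXY hx) (hXY hgx)

theorem comap {K : Type*} [Group K] (f : K →* H) (h : ContainsConjugators M X) :
    ContainsConjugators (M.comap f) (f ⁻¹' X) :=
  fun k x hx hkx => h (h := f k) hx (by simpa using hkx)

theorem le {T N : Subgroup H} (h : ContainsConjugators M (T \ N : Set H)) (hTN : ¬ T ≤ N) :
    T ≤ M := by
  have mem_of_notMem : ∀ t ∈ T, t ∉ N → t ∈ M := fun t ht htN =>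
    h (h := t) (x := t) ⟨ht, htN⟩ (by simpa using And.intro ht htN)
  obtain ⟨t, ht, htN⟩ := SetLike.not_le_iff_exists.mp hTN
  intro y hy
  by_cases hyN : y ∈ N
  · have hty : t * y ∈ M :=
      mem_of_notMem _ (mul_mem ht hy) (by rwa [N.mul_mem_cancel_right hyN])
    exact (M.mul_mem_cancel_left (mem_of_notMem t ht htN)).mp hty
  · exact mem_of_notMem y hy hyN

theorem sylow_le [Finite H] (h : ContainsConjugators M {x | x ∈ M ∧ orderOf x = p})
    {T : Sylow p H} {x : H} (hx : x ∈ M ∧ orderOf x = p) (hxT : x ∈ T) : T ≤ M := by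
  have : Nontrivial T :=
    nontrivial_of_ne ⟨x, hxT⟩ 1 fun hx1 => ne_one_of_orderOf_eq hx.2 (congrArg Subtype.val hx1)
  obtain ⟨z, hz, hzp⟩ := exists_mem_center_orderOf_eq_prime T.isPGroup'
  have conj_eq : ∀ t ∈ T, t * z * t⁻¹ = (z : H) := fun t ht => by
    rw [mul_inv_eq_iff_eq_mul]
    exact congrArg Subtype.val (Subgroup.mem_center_iff.mp hz ⟨t, ht⟩)
  have hzM : (z : H) ∈ M := by
    have hzx : z * x * (z : H)⁻¹ = x := by
      rw [mul_inv_eq_iff_eq_mul, ← mul_inv_eq_iff_eq_mul.mp (conj_eq x hxT)]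
    exact h hx (by rwa [hzx])
  have hz' : (z : H) ∈ M ∧ orderOf (z : H) = p := ⟨hzM, by rwa [Subgroup.orderOf_coe]⟩
  exact fun t ht => h hz' (by rwa [conj_eq t ht])

theorem diff_bot_of_orderOf (h : ContainsConjugators M {x | x ∈ M ∧ orderOf x = p})
    {T : Subgroup H} (hT : IsPGroup p T) (hTM : T ≤ M) :
    ContainsConjugators M (T \ (⊥ : Subgroup H) : Set H) := by
  rintro k y ⟨hyT, hy1⟩ ⟨hkyT, -⟩
  obtain ⟨i, hi⟩ := exists_pow_orderOf_eq_prime hT (x := ⟨y, hyT⟩) (by simpa using hy1)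
  have hi' : orderOf (y ^ i) = p := by rwa [← Subgroup.orderOf_coe] at hi
  refine h (x := y ^ i) ⟨pow_mem (hTM hyT) i, hi'⟩ ⟨?_, by rwa [orderOf_conj]⟩
  rw [← conj_pow]
  exact pow_mem (hTM hkyT) i

theorem orderOf_of_diff_bot [Finite H] {T : Sylow p H}
    (h : ContainsConjugators M (T \ (⊥ : Subgroup H) : Set H)) (hTM : T ≤ M) :
    ContainsConjugators M {x | x ∈ M ∧ orderOf x = p} := by
  have exists_conj : ∀ x, x ∈ M ∧ orderOf x = p →
      ∃ m ∈ M, m * x * m⁻¹ ∈ (T \ (⊥ : Subgroup H) : Set H) := by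
    rintro x ⟨hxM, hxp⟩
    obtain ⟨m, hm⟩ := exists_conj_mem_sylow_of_orderOf_eq (T.subtype hTM) (x := ⟨x, hxM⟩)
      (by rwa [Subgroup.orderOf_mk])
    exact ⟨m, m.2, hm, ne_one_of_orderOf_eq ((orderOf_conj (m : H) x).trans hxp)⟩
  intro k x hx hkx
  obtain ⟨m, hm, hmx⟩ := exists_conj x hx
  obtain ⟨m', hm', hmx'⟩ := exists_conj _ hkx
  have hmem : m' * k * m⁻¹ ∈ M := h hmx (by simpa [mul_assoc] using hmx')
  rwa [M.mul_mem_cancel_right (inv_mem hm), M.mul_mem_cancel_left hm'] at hmem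

end ContainsConjugators

theorem hasStronglyEmbedded_iff_orderOf [Finite H] :
    HasStronglyEmbedded p H ↔ ∃ M : Subgroup H, M ≠ ⊤ ∧ (∃ x ∈ M, orderOf x = p) ∧
      ContainsConjugators M {x | x ∈ M ∧ orderOf x = p} := by
  unfold HasStronglyEmbedded
  simp only [prime_dvd_card_iff_exists_orderOf_eq]
  refine exists_congr fun M => and_congr_right fun _ => and_congr_right fun _ => ?_
  constructor
  · rintro hM h x ⟨hxM, hxp⟩ ⟨hhxM, -⟩
    by_contra hh
    exact hM h hh ⟨_, ⟨hhxM, x, hxM, rfl⟩, by rw [orderOf_conj, hxp]⟩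
  · rintro hM h hh ⟨_, ⟨hhxM, x, hxM, rfl⟩, hxp⟩
    have hxp' : orderOf x = p := (orderOf_conj h x).symm.trans hxp
    exact hh (hM ⟨hxM, hxp'⟩ ⟨hhxM, hxp⟩)

theorem hasStronglyEmbedded_iff [Finite H] (T : Sylow p H) :
    HasStronglyEmbedded p H ↔ (T : Subgroup H) ≠ ⊥ ∧
      ∃ M : Subgroup H, M ≠ ⊤ ∧ ContainsConjugators M (T \ (⊥ : Subgroup H) : Set H) := by
  rw [hasStronglyEmbedded_iff_orderOf]
  constructor
  · rintro ⟨M, hM, ⟨x, hxM, hxp⟩, hMc⟩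
    obtain ⟨g, hgx⟩ := exists_conj_mem_sylow_of_orderOf_eq T hxp
    let f := (MulAut.conj g⁻¹).toMonoidHom
    have hfgx : f (g * x * g⁻¹) = x := by simp [f, mul_assoc]
    have hMf : ContainsConjugators (M.comap f) {y | y ∈ M.comap f ∧ orderOf y = p} :=
      (hMc.comap f).mono fun y hy => ⟨hy.1, ((MulAut.conj g⁻¹).orderOf_eq y).trans hy.2⟩
    have hTM : T ≤ M.comap f :=
      hMf.sylow_le ⟨by rwa [Subgroup.mem_comap, hfgx], (orderOf_conj g x).trans hxp⟩ hgx
    have hTbot : (T : Subgroup H) ≠ ⊥ := fun h => ne_one_of_orderOf_eq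
      ((orderOf_conj g x).trans hxp) ((Subgroup.eq_bot_iff_forall _).mp h _ hgx)
    refine ⟨hTbot, M.comap f, fun h => hM ?_, hMf.diff_bot_of_orderOf T.isPGroup' hTM⟩
    exact Subgroup.comap_injective (MulAut.conj g⁻¹).surjective
      (h.trans (Subgroup.comap_top f).symm)
  · rintro ⟨hT, M, hM, hMc⟩
    have hTM : T ≤ M := hMc.le (by rwa [le_bot_iff])
    obtain ⟨⟨t, ht⟩, ht1⟩ := Subgroup.ne_bot_iff_exists_ne_one.mp hT
    obtain ⟨i, hi⟩ := exists_pow_orderOf_eq_prime T.isPGroup' (x := ⟨t, ht⟩) ht1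
    exact ⟨M, hM, ⟨t ^ i, pow_mem (hTM ht) i, by rwa [← Subgroup.orderOf_coe] at hi⟩,
      hMc.orderOf_of_diff_bot hTM⟩

theorem hasStronglyEmbedded_quotient_iff {K : Type*} [Group K] [Finite K] {N : Subgroup K}
    [N.Normal] {T : Sylow p K} (hNT : N ≤ T) :
    HasStronglyEmbedded p (K ⧸ N) ↔ ¬ T ≤ N ∧
      ∃ M : Subgroup K, M ≠ ⊤ ∧ ContainsConjugators M (T \ N : Set K) := by
  have hπ := QuotientGroup.mk'_surjective N
  have comap_map : ∀ L : Subgroup K, N ≤ L →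
      (L.map (QuotientGroup.mk' N)).comap (QuotientGroup.mk' N) = L := fun L hL => by
    rw [Subgroup.comap_map_eq, QuotientGroup.ker_mk', sup_eq_left.mpr hL]
  have preimage_eq : QuotientGroup.mk' N ⁻¹'
      ((T : Subgroup K).map (QuotientGroup.mk' N) \ (⊥ : Subgroup (K ⧸ N)) : Set (K ⧸ N)) =
      (T \ N : Set K) := by
    rw [Set.preimage_sdiff, ← Subgroup.coe_comap, comap_map T hNT, ← Subgroup.coe_comap,
      MonoidHom.comap_bot, QuotientGroup.ker_mk']
    rfl
  rw [hasStronglyEmbedded_iff (T.mapSurjective hπ), Sylow.coe_mapSurjective, Ne,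
    Subgroup.map_eq_bot_iff, QuotientGroup.ker_mk']
  refine and_congr_right fun hTN => ?_
  constructor
  · rintro ⟨M, hM, hMc⟩
    refine ⟨M.comap (QuotientGroup.mk' N), ?_, preimage_eq ▸ hMc.comap (QuotientGroup.mk' N)⟩
    exact fun h => hM (Subgroup.comap_injective hπ (h.trans (Subgroup.comap_top _).symm))
  · rintro ⟨M, hM, hMc⟩
    refine ⟨M.map (QuotientGroup.mk' N), fun h => hM ?_, ?_⟩
    · rw [← comap_map M (hNT.trans (hMc.le hTN)), h, Subgroup.comap_top]
    · intro h y hy hhy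
      obtain ⟨k, rfl⟩ := hπ h
      obtain ⟨x, rfl⟩ := hπ y
      exact ⟨k, hMc (preimage_eq.le hy) (preimage_eq.le hhy), rfl⟩

theorem conj_mem_iff {N : Subgroup H} [hN : N.Normal] {g x : H} : g * x * g⁻¹ ∈ N ↔ x ∈ N := by
  rw [hN.mem_comm_iff, inv_mul_cancel_left]

/-- The elements that conjugate `B` into `T` up to a left factor in `M`. If `M` is strongly
`p`-embedded and contains the Sylow `p`-subgroup `T`, then for a nontrivial `p`-subgroup `B` they
form a single coset `M * k`, which serves as a label that `p`-subgroups with a common nontrivial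
element share. -/
def label (M T B : Subgroup H) : Set H :=
  {k | ∃ m ∈ M, ∀ b ∈ B, (m * k) * b * (m * k)⁻¹ ∈ T}

theorem mem_label_of_conj_mem {M T B : Subgroup H} {k : H} (h : ∀ b ∈ B, k * b * k⁻¹ ∈ T) :
    k ∈ label M T B :=
  ⟨1, one_mem M, by simpa only [one_mul] using h⟩

namespace ContainsConjugators

variable {M N : Subgroup H} {T : Sylow p H}

theorem mem_of_mem_label {T B : Subgroup H} [N.Normal]
    (hM : ContainsConjugators M (T \ N : Set H)) (hBT : B ≤ T) {y : H} (hyB : y ∈ B) (hyN : y ∉ N)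
    {k : H} (hk : k ∈ label M T B) : k ∈ M := by
  obtain ⟨m, hm, hmk⟩ := hk
  have hmkM : m * k ∈ M := hM ⟨hBT hyB, hyN⟩
    ⟨hmk y hyB, fun h => hyN (conj_mem_iff.mp h)⟩
  exact (M.mul_mem_cancel_left hm).mp hmkM

theorem label_subset [Finite (Sylow p H)] [N.Normal]
    (hM : ContainsConjugators M (T \ N : Set H)) {B B' : Subgroup H} (hB' : IsPGroup p B') {y : H}
    (hyB : y ∈ B) (hyB' : y ∈ B') (hyN : y ∉ N) : label M T B ⊆ label M T B' := by
  rintro k ⟨m, hm, hmk⟩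
  obtain ⟨h, hh⟩ := exists_conj_mem_sylow T hB'
  have conj_notMem : ∀ g : H, g * y * g⁻¹ ∉ N := fun g hg =>
    hyN (conj_mem_iff.mp hg)
  have hmem : h * (m * k)⁻¹ ∈ M := by
    refine hM ⟨hmk y hyB, conj_notMem _⟩ ?_
    have : h * (m * k)⁻¹ * (m * k * y * (m * k)⁻¹) * (h * (m * k)⁻¹)⁻¹ = h * y * h⁻¹ := by group
    rw [this]
    exact ⟨hh y hyB', conj_notMem h⟩
  refine ⟨h * (m * k)⁻¹ * m, mul_mem hmem hm, ?_⟩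
  rwa [show h * (m * k)⁻¹ * m * k = h by group]

theorem label_eq [Finite (Sylow p H)] [N.Normal] (hM : ContainsConjugators M (T \ N : Set H))
    {B B' : Subgroup H} (hB : IsPGroup p B) (hB' : IsPGroup p B') {y : H} (hyB : y ∈ B)
    (hyB' : y ∈ B') (hyN : y ∉ N) : label M T B = label M T B' :=
  (hM.label_subset hB' hyB hyB' hyN).antisymm (hM.label_subset hB hyB' hyB hyN)

end ContainsConjugators

end StronglyEmbedded


section Automizers

variable {S : Type*} [Group S]

theorem IsSylowOf.exists_conj_mem {p : ℕ} [Fact p.Prime] {G : Type*} [Group G] [Finite G]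
    {T A B : Subgroup G} (h : IsSylowOf p T A) (hBA : B ≤ A) (hB : IsPGroup p B) :
    ∃ a ∈ A, ∀ b ∈ B, a * b * a⁻¹ ∈ T := by
  obtain ⟨U, rfl⟩ := h
  obtain ⟨a, ha⟩ := exists_conj_mem_sylow U (B := B.subgroupOf A) hB.comap_subtype
  exact ⟨a, a.2, fun b hb => ⟨_, ha ⟨b, hBA hb⟩ hb, rfl⟩⟩

theorem isSylowOf_iff_card {p : ℕ} [Fact p.Prime] {G : Type*} [Group G] [Finite G]
    {T A : Subgroup G} :
    IsSylowOf p T A ↔ T ≤ A ∧ Nat.card T = p ^ (Nat.card A).factorization p := by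
  constructor
  · rintro ⟨U, rfl⟩
    refine ⟨Subgroup.map_subtype_le _, ?_⟩
    rw [Subgroup.card_map_of_injective A.subtype_injective, U.card_eq_multiplicity]
  · rintro ⟨hTA, hT⟩
    refine ⟨Sylow.ofCard (T.subgroupOf A) ?_, Subgroup.map_subgroupOf_eq_of_le hTA⟩
    rw [Nat.card_congr (Subgroup.subgroupOfEquivOfLe hTA).toEquiv, hT]

/-- The automorphisms of `G` that become conjugation by an element of `S` under a homomorphism
`ψ : G →* S`; for injective `ψ` they form the preimage of `Aut_S(ψ(G))` in `Aut(G)`. -/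
def autVia {G : Type*} [Group G] (ψ : G →* S) : Subgroup (MulAut G) where
  carrier := {a | ∃ g : S, ∀ x, ψ (a x) = g * ψ x * g⁻¹}
  one_mem' := ⟨1, fun x => by simp⟩
  mul_mem' := by
    rintro a b ⟨g, hg⟩ ⟨h, hh⟩
    exact ⟨g * h, fun x => by rw [MulAut.mul_apply, hg, hh]; group⟩
  inv_mem' := by
    rintro a ⟨g, hg⟩
    refine ⟨g⁻¹, fun x => ?_⟩
    have hx := hg (a⁻¹ x)
    rw [MulAut.apply_inv_self] at hx
    rw [hx]
    group

theorem mem_autVia {G : Type*} [Group G] {ψ : G →* S} {a : MulAut G} :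
    a ∈ autVia ψ ↔ ∃ g : S, ∀ x, ψ (a x) = g * ψ x * g⁻¹ := Iff.rfl

theorem isPGroup_autVia {p : ℕ} (hS : IsPGroup p S) {G : Type*} [Group G] {ψ : G →* S}
    (hψ : Function.Injective ψ) : IsPGroup p (autVia ψ) := by
  rintro ⟨a, g, hg⟩
  obtain ⟨n, hn⟩ := hS g
  have apply_pow : ∀ (k : ℕ) x, ψ ((a ^ k) x) = g ^ k * ψ x * (g ^ k)⁻¹ := by
    intro k
    induction k with
    | zero => simp
    | succ k ih =>
      intro x
      rw [pow_succ', MulAut.mul_apply, hg, ih, pow_succ']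
      group
  refine ⟨n, Subtype.ext (MulEquiv.ext fun x => hψ ?_)⟩
  exact (apply_pow (p ^ n) x).trans (by simp [hn])

theorem autVia_conj_comp {G : Type*} [Group G] (g : S) (ψ : G →* S) :
    autVia ((MulAut.conj g).toMonoidHom.comp ψ) = autVia ψ := by
  ext a
  rw [mem_autVia, mem_autVia, (MulAut.conj g).surjective.exists]
  refine exists_congr fun k => forall_congr' fun x => ?_
  change MulAut.conj g _ = MulAut.conj g k * MulAut.conj g (ψ x) * (MulAut.conj g k)⁻¹ ↔ _
  rw [← map_inv, ← map_mul, ← map_mul, (MulAut.conj g).injective.eq_iff]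

theorem conj_mem_autVia_of_mem_autVia_comp {G : Type*} [Group G] {ψ : G →* S} {a b : MulAut G}
    (hb : b ∈ autVia (ψ.comp a.toMonoidHom)) : a * b * a⁻¹ ∈ autVia ψ := by
  obtain ⟨g, hg⟩ := hb
  refine ⟨g, fun x => ?_⟩
  simpa using hg (a⁻¹ x)

theorem mem_autS_iff {P : Subgroup S} {a : MulAut P} :
    a ∈ autS P ↔ ∃ g : S, ∀ x : P, (a x : S) = g * x * g⁻¹ := by
  constructor
  · rintro ⟨g, rfl⟩
    exact ⟨g, fun x => rfl⟩
  · rintro ⟨g, hg⟩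
    have hgN : g ∈ Subgroup.normalizer (P : Set S) := by
      refine Subgroup.mem_normalizer_iff.mpr fun x =>
        ⟨fun hx => hg ⟨x, hx⟩ ▸ (a ⟨x, hx⟩).2, fun hx => ?_⟩
      have h := hg (a.symm ⟨_, hx⟩)
      rw [MulEquiv.apply_symm_apply] at h
      have hx' : x = (a.symm ⟨_, hx⟩ : P) := by simpa using h
      exact hx' ▸ Subtype.prop _
    exact ⟨⟨g, hgN⟩, MulEquiv.ext fun x => Subtype.ext (hg x).symm⟩

theorem autS_eq_autVia (P : Subgroup S) : autS P = autVia P.subtype :=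
  Subgroup.ext fun _ => mem_autS_iff

theorem isPGroup_autS {p : ℕ} (hS : IsPGroup p S) (P : Subgroup S) : IsPGroup p (autS P) :=
  autS_eq_autVia P ▸ isPGroup_autVia hS P.subtype_injective

theorem inn_le_autS (P : Subgroup S) : inn P ≤ autS P := by
  rintro _ ⟨g, rfl⟩
  exact mem_autS_iff.mpr ⟨g, fun x => rfl⟩

theorem isCentricIn_iff {P : Subgroup S} :
    IsCentricIn P ↔ Subgroup.centralizer (P : Set S) ≤ P := by
  constructor
  · intro h
    rw [IsCentricIn] at h
    exact h ▸ Subgroup.map_subtype_le _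
  · intro h
    apply le_antisymm
    · intro c hc
      refine ⟨⟨c, h hc⟩, Subgroup.mem_center_iff.mpr fun x => Subtype.ext ?_, rfl⟩
      exact Subgroup.mem_centralizer_iff.mp hc x x.2
    · rintro _ ⟨c, hc, rfl⟩
      refine Subgroup.mem_centralizer_iff.mpr fun x hx => ?_
      exact congrArg Subtype.val (Subgroup.mem_center_iff.mp hc ⟨x, hx⟩)

theorem isCentricIn_top : IsCentricIn (⊤ : Subgroup S) := isCentricIn_iff.mpr le_top

theorem IsCentricIn.mem_of_mem_inn {P : Subgroup S} (hP : IsCentricIn P) {a : MulAut P}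
    (ha : a ∈ inn P) {g : S} (hg : ∀ x : P, (a x : S) = g * x * g⁻¹) : g ∈ P := by
  obtain ⟨y, rfl⟩ := ha
  have hc : (y : S)⁻¹ * g ∈ P := by
    refine isCentricIn_iff.mp hP (Subgroup.mem_centralizer_iff.mpr fun x hx => ?_)
    have hx' : (y : S) * x * (y : S)⁻¹ = g * x * g⁻¹ := hg ⟨x, hx⟩
    rw [mul_assoc, mul_inv_eq_iff_eq_mul.mp hx'.symm]
    group
  exact (P.mul_mem_cancel_left (inv_mem y.2)).mp hc

theorem IsCentricIn.card_normalizer {P : Subgroup S} (hP : IsCentricIn P) :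
    Nat.card (Subgroup.normalizer (P : Set S)) =
      Nat.card (Subgroup.center P) * Nat.card (autS P) := by
  have card_ker : Nat.card P.normalizerMonoidHom.ker = Nat.card (Subgroup.center P) := by
    rw [IsCentricIn] at hP
    rw [Subgroup.normalizerMonoidHom_ker, Nat.card_congr (Subgroup.subgroupOfEquivOfLe
      (Subgroup.centralizer_le_normalizer (P : Set S))).toEquiv, hP,
      Subgroup.card_map_of_injective P.subtype_injective]
  rw [← card_ker, autS, ← Subgroup.index_ker, Subgroup.card_mul_index]

theorem exists_mem_normalizer_notMem {p : ℕ} [Fact p.Prime] [Finite S] (hS : IsPGroup p S)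
    {P Q : Subgroup S} (h : P < Q) :
    ∃ g ∈ Q, g ∈ Subgroup.normalizer (P : Set S) ∧ g ∉ P := by
  have hn : Group.IsNilpotent Q := (hS.to_subgroup Q).isNilpotent
  have hlt := Group.normalizerCondition_of_isNilpotent (G := Q) (P.subgroupOf Q)
    (lt_top_iff_ne_top.mpr fun h' => h.not_ge (Subgroup.subgroupOf_eq_top.mp h'))
  rw [← Subgroup.subgroupOf_normalizer_eq h.le] at hlt
  obtain ⟨⟨g, hgQ⟩, hg, hgP⟩ := SetLike.exists_of_lt hlt
  exact ⟨g, hgQ, hg, hgP⟩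

theorem autS_not_le_inn {p : ℕ} [Fact p.Prime] [Finite S] (hS : IsPGroup p S) {P : Subgroup S}
    (hP : IsCentricIn P) (hlt : P < ⊤) : ¬ autS P ≤ inn P := by
  obtain ⟨g, -, hgN, hgP⟩ := exists_mem_normalizer_notMem hS hlt
  exact fun h => hgP (hP.mem_of_mem_inn (h ⟨⟨g, hgN⟩, rfl⟩) fun x => rfl)

theorem image_le {P Q : Subgroup S} (φ : P →* Q) : image φ ≤ Q := by
  rintro _ ⟨x, rfl⟩
  exact (φ x).2

theorem exists_mem_autVia_comp_notMem_inn {p : ℕ} [Fact p.Prime] [Finite S] (hS : IsPGroup p S)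
    {E Q : Subgroup S} {ψ : E →* Q} (hψ : Function.Injective ψ) (hlt : image ψ < Q)
    (hc : IsCentricIn (image ψ)) :
    ∃ y : MulAut E, y ∉ inn E ∧ ∀ χ : Q →* S, y ∈ autVia (χ.comp ψ) := by
  obtain ⟨g, hgQ, hgN, hg⟩ := exists_mem_normalizer_notMem hS hlt
  let e : E ≃* image ψ := MonoidHom.ofInjective (Q.subtype_injective.comp hψ)
  have he : ∀ x, (e x : S) = ψ x := fun x => rfl
  let c : MulAut (image ψ) := (image ψ).normalizerMonoidHom ⟨g, hgN⟩
  have hy : ∀ x, ψ ((MulAut.congr e).symm c x) = ⟨g, hgQ⟩ * ψ x * ⟨g, hgQ⟩⁻¹ := fun x => by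
    apply Subtype.ext
    rw [← he]
    exact congrArg Subtype.val (e.apply_symm_apply (c (e x)))
  refine ⟨(MulAut.congr e).symm c, ?_, fun χ => ⟨χ ⟨g, hgQ⟩, fun x => ?_⟩⟩
  · rintro ⟨z, hz⟩
    refine hg (hc.mem_of_mem_inn (a := c) ⟨e z, ?_⟩ fun x => rfl)
    rw [← (MulAut.congr e).apply_symm_apply c, ← hz]
    ext x
    simp [MulAut.congr]
  · simp only [MonoidHom.comp_apply, hy, map_mul, map_inv]

end Automizers

namespace FusionSystem

variable {S : Type*} [Group S]

/-- Fusion systems on `S` are ordered by inclusion of their sets of morphisms. -/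
instance : PartialOrder (FusionSystem S) :=
  PartialOrder.lift FusionSystem.hom fun _ _ h => FusionSystem.ext h

theorem generate_le_iff {X : (P : Subgroup S) → Set (MulAut P)} {F : FusionSystem S} :
    generate X ≤ F ↔ ∀ P, ∀ a ∈ X P, a ∈ F.aut P :=
  ⟨fun h P _ ha => h P P fun _ hG => hG P _ ha, fun h _ _ _ hφ => hφ F h⟩

section Morphisms

variable {F : FusionSystem S}

/-- `Iso_F(P, Q)`: the isomorphisms from `P` onto `Q` that are morphisms of `F`. -/
def iso (F : FusionSystem S) (P Q : Subgroup S) : Set (P ≃* Q) :=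
  {α | α.toMonoidHom ∈ F.hom P Q}

theorem inclusion_mem (F : FusionSystem S) {P Q : Subgroup S} (h : P ≤ Q) :
    Subgroup.inclusion h ∈ F.hom P Q :=
  F.homS_subset _ _ ⟨1, fun x => by simp⟩

theorem mem_of_coe_eq {P Q P' Q' : Subgroup S} {φ : P →* Q} (hφ : φ ∈ F.hom P Q) (hP : P' ≤ P)
    {ψ : P' →* Q'} (h : ∀ x : P', (ψ x : S) = φ (Subgroup.inclusion hP x)) :
    ψ ∈ F.hom P' Q' := by
  obtain ⟨e, he, hem, -⟩ := F.factor (F.comp_mem (F.inclusion_mem hP) hφ)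
  have hle : image (φ.comp (Subgroup.inclusion hP)) ≤ Q' := by
    rintro _ ⟨x, rfl⟩
    have hx : (φ (Subgroup.inclusion hP x) : S) ∈ Q' := h x ▸ (ψ x).2
    exact hx
  have hψ : ψ = (Subgroup.inclusion hle).comp e.toMonoidHom :=
    MonoidHom.ext fun x => Subtype.ext ((h x).trans (he x).symm)
  exact hψ ▸ F.comp_mem hem (F.inclusion_mem hle)

theorem iso_symm_mem {P Q : Subgroup S} {α : P ≃* Q} (hα : α ∈ F.iso P Q) :
    α.symm ∈ F.iso Q P := by
  obtain ⟨e, he, -, hs⟩ := F.factor hα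
  have hle : Q ≤ image α.toMonoidHom := fun x hx => ⟨α.symm ⟨x, hx⟩, by simp⟩
  refine mem_of_coe_eq hs hle fun x => congrArg Subtype.val ?_
  change α.symm x = e.symm (Subgroup.inclusion hle x)
  rw [eq_comm, MulEquiv.symm_apply_eq]
  refine Subtype.ext ?_
  rw [he]
  exact congrArg Subtype.val (α.apply_symm_apply x).symm

theorem iso_trans_mem {P Q R : Subgroup S} {α : P ≃* Q} {β : Q ≃* R} (hα : α ∈ F.iso P Q)
    (hβ : β ∈ F.iso Q R) : α.trans β ∈ F.iso P R :=
  F.comp_mem hα hβ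

theorem mem_of_comp_mem {P Q R : Subgroup S} {φ : P →* Q} {ψ : Q →* R} (hψ : ψ ∈ F.hom Q R)
    (h : ψ.comp φ ∈ F.hom P R) : φ ∈ F.hom P Q := by
  obtain ⟨e, he, -, hs⟩ := F.factor hψ
  have heφ : e.toMonoidHom.comp φ ∈ F.hom P (image ψ) := mem_of_coe_eq h le_rfl fun x => he (φ x)
  have hφ : φ = e.symm.toMonoidHom.comp (e.toMonoidHom.comp φ) :=
    MonoidHom.ext fun x => (e.symm_apply_apply (φ x)).symm
  exact hφ ▸ F.comp_mem heφ hs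

theorem conj_comp_mem {P Q R : Subgroup S} {φ : P →* Q} (hφ : φ ∈ F.hom P Q) {χ : P →* R}
    (g : S) (h : ∀ x, (χ x : S) = g * φ x * g⁻¹) : χ ∈ F.hom P R := by
  let c : Q →* (⊤ : Subgroup S) :=
    ((MulAut.conj g).toMonoidHom.comp Q.subtype).codRestrict ⊤ fun _ => Subgroup.mem_top _
  have hc : c ∈ F.hom Q ⊤ := F.homS_subset _ _ ⟨g, fun x => rfl⟩
  exact mem_of_coe_eq (F.comp_mem hφ hc) le_rfl h

theorem autVia_le_aut {P Q : Subgroup S} {φ : P →* Q} (hφ : φ ∈ F.hom P Q) :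
    autVia (Q.subtype.comp φ) ≤ F.aut P :=
  fun _ ⟨g, hg⟩ => mem_of_comp_mem hφ (conj_comp_mem hφ g hg)

theorem autS_le_aut (P : Subgroup S) : autS P ≤ F.aut P :=
  autS_eq_autVia P ▸ autVia_le_aut (F.refl_mem P)

theorem congr_mem_aut {P Q : Subgroup S} {α : P ≃* Q} (hα : α ∈ F.iso P Q) {a : MulAut P}
    (ha : a ∈ F.aut P) : MulAut.congr α a ∈ F.aut Q :=
  iso_trans_mem (iso_symm_mem hα) (iso_trans_mem (P := P) (Q := P) ha hα)

theorem congr_mem_aut_iff {P Q : Subgroup S} {α : P ≃* Q} (hα : α ∈ F.iso P Q) {a : MulAut P} :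
    MulAut.congr α a ∈ F.aut Q ↔ a ∈ F.aut P := by
  refine ⟨fun ha => ?_, congr_mem_aut hα⟩
  convert congr_mem_aut (iso_symm_mem hα) ha using 1
  ext x
  simp [MulAut.congr]

end Morphisms

section Conjugacy

variable {F : FusionSystem S} {P Q R : Subgroup S}

theorem Conj.exists_iso (h : F.Conj P Q) : ∃ α : P ≃* Q, α ∈ F.iso P Q := by
  obtain ⟨φ, hφ, rfl⟩ := h
  obtain ⟨e, -, he, -⟩ := F.factor hφ
  exact ⟨e, he⟩

theorem conj_of_iso {α : P ≃* Q} (h : α ∈ F.iso P Q) : F.Conj P Q := by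
  refine ⟨_, F.comp_mem h (F.inclusion_mem le_top), Subgroup.ext fun x => ?_⟩
  exact ⟨by rintro ⟨y, rfl⟩; exact (α y).2, fun hx => ⟨α.symm ⟨x, hx⟩, by simp⟩⟩

theorem conj_image {φ : P →* Q} (hφ : φ ∈ F.hom P Q) : F.Conj P (image φ) := by
  obtain ⟨e, -, he, -⟩ := F.factor hφ
  exact conj_of_iso he

theorem Conj.refl (P : Subgroup S) : F.Conj P P :=
  conj_of_iso (α := MulEquiv.refl P) (F.refl_mem P)

theorem Conj.symm (h : F.Conj P Q) : F.Conj Q P :=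
  let ⟨_, hα⟩ := h.exists_iso
  conj_of_iso (iso_symm_mem hα)

theorem Conj.trans (h : F.Conj P Q) (h' : F.Conj Q R) : F.Conj P R :=
  let ⟨_, hα⟩ := h.exists_iso
  let ⟨_, hβ⟩ := h'.exists_iso
  conj_of_iso (iso_trans_mem hα hβ)

theorem Conj.card_eq (h : F.Conj P Q) : Nat.card P = Nat.card Q :=
  let ⟨α, _⟩ := h.exists_iso
  Nat.card_congr α.toEquiv

theorem Conj.card_center_eq (h : F.Conj P Q) :
    Nat.card (Subgroup.center P) = Nat.card (Subgroup.center Q) :=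
  let ⟨α, _⟩ := h.exists_iso
  Nat.card_congr (Subgroup.centerCongr α).toEquiv

theorem Conj.card_aut_eq (h : F.Conj P Q) : Nat.card (F.aut P) = Nat.card (F.aut Q) := by
  obtain ⟨α, hα⟩ := h.exists_iso
  exact Nat.card_congr
    ((MulAut.congr α).toEquiv.subtypeEquiv fun _ => (congr_mem_aut_iff hα).symm)

theorem Conj.eq_top [Finite S] (h : F.Conj ⊤ Q) : Q = ⊤ :=
  Subgroup.eq_top_of_card_eq Q (by rw [← h.card_eq, Subgroup.card_top])

theorem isCentric_top [Finite S] : F.IsCentric ⊤ :=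
  fun _ hQ => hQ.eq_top ▸ isCentricIn_top

theorem IsCentric.isCentricIn (h : F.IsCentric P) : IsCentricIn P :=
  h P (Conj.refl P)

variable {p : ℕ} [Fact p.Prime] [Finite S]

theorem card_autS_le (hS : IsPGroup p S) (F : FusionSystem S) (P : Subgroup S) :
    Nat.card (autS P) ≤ p ^ (Nat.card (F.aut P)).factorization p := by
  obtain ⟨n, hn⟩ := IsPGroup.iff_card.mp (isPGroup_autS hS P)
  rw [hn]
  refine Nat.pow_le_pow_right (Fact.out : p.Prime).pos ?_
  rw [← (Fact.out : p.Prime).pow_dvd_iff_le_factorization Nat.card_pos.ne', ← hn]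
  exact Subgroup.card_dvd_of_le (autS_le_aut P)

theorem isFullyAutomized_iff : F.IsFullyAutomized p P ↔
    Nat.card (autS P) = p ^ (Nat.card (F.aut P)).factorization p :=
  isSylowOf_iff_card.trans (and_iff_right (autS_le_aut P))

theorem IsFullyAutomized.isFullyNormalized (hS : IsPGroup p S) (h : F.IsFullyAutomized p P)
    (hc : F.IsCentric P) : F.IsFullyNormalized P := by
  intro Q hQ
  rw [(hc Q hQ).card_normalizer, hc.isCentricIn.card_normalizer, hQ.card_center_eq,
    isFullyAutomized_iff.mp h, hQ.card_aut_eq]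
  exact Nat.mul_le_mul_left _ (card_autS_le hS F Q)

theorem IsFullyNormalized.isFullyAutomized (hS : IsPGroup p S) (hF : F.IsSaturated p)
    (h : F.IsFullyNormalized P) (hc : F.IsCentric P) : F.IsFullyAutomized p P := by
  obtain ⟨Q, hQ, hQA, -⟩ := hF P
  have hN := h Q hQ
  rw [(hc Q hQ).card_normalizer, hc.isCentricIn.card_normalizer, hQ.card_center_eq,
    isFullyAutomized_iff.mp hQA, ← hQ.card_aut_eq] at hN
  exact isFullyAutomized_iff.mpr
    ((card_autS_le hS F P).antisymm (Nat.le_of_mul_le_mul_left hN Nat.card_pos))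

end Conjugacy

section Preserving

variable {α : Sort*} {E : Subgroup S} {ℓ : (E →* S) → α}

/-- The subsystem of `F` of all morphisms `φ : P → Q` that preserve a labelling `ℓ` of the
embeddings of `E` into `S`, that is, for which every `ψ ∈ Hom_F(E, P)` has the same label as
`φ ∘ ψ`. It serves to bound a generated fusion system from above. -/
def preserving (F : FusionSystem S) (ℓ : (E →* S) → α)
    (hℓ : ∀ (g : S) (χ : E →* S), ℓ ((MulAut.conj g).toMonoidHom.comp χ) = ℓ χ) :
    FusionSystem S where
  hom P Q := {φ | φ ∈ F.hom P Q ∧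
    ∀ ψ ∈ F.hom E P, ℓ (Q.subtype.comp (φ.comp ψ)) = ℓ (P.subtype.comp ψ)}
  comp_mem := fun ⟨hφ, hφℓ⟩ ⟨hψ, hψℓ⟩ =>
    ⟨F.comp_mem hφ hψ, fun χ hχ => (hψℓ _ (F.comp_mem hχ hφ)).trans (hφℓ χ hχ)⟩
  homS_subset := fun P Q φ hφ => ⟨F.homS_subset P Q hφ, fun ψ _ => by
    obtain ⟨g, hg⟩ := hφ
    rw [← hℓ g (P.subtype.comp ψ)]
    exact congrArg ℓ (MonoidHom.ext fun x => hg (ψ x))⟩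
  injective := fun h => F.injective h.1
  factor := by
    rintro P Q φ ⟨hφ, hφℓ⟩
    obtain ⟨e, he, hem, hs⟩ := F.factor hφ
    have subtype_comp : ∀ ψ : E →* P,
        (image φ).subtype.comp (e.toMonoidHom.comp ψ) = Q.subtype.comp (φ.comp ψ) :=
      fun ψ => MonoidHom.ext fun x => he (ψ x)
    refine ⟨e, he, ⟨hem, fun ψ hψ => subtype_comp ψ ▸ hφℓ ψ hψ⟩, hs, fun ψ hψ => ?_⟩
    rw [← hφℓ _ (F.comp_mem hψ hs), ← subtype_comp]
    exact congrArg ℓ (MonoidHom.ext fun x => by simp)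

end Preserving

section StronglyEmbedded

variable {S : Type*} [Group S] [Finite S] {p : ℕ} [Fact p.Prime] {E : Subgroup S}

theorem label_autVia_comp_eq (hS : IsPGroup p S) {F : FusionSystem S} (hE : F.IsCentric E)
    {M : Subgroup (F.aut E)} {T : Sylow p (F.aut E)}
    (hM : ContainsConjugators M (T \ (inn E).subgroupOf (F.aut E) : Set (F.aut E)))
    {Q : Subgroup S} (hQ : ¬ F.Conj E Q) {ψ : E →* Q} (hψ : ψ ∈ F.hom E Q) {φ : Q →* Q}
    (hφ : φ ∈ F.hom Q Q) :
    label M T ((autVia (Q.subtype.comp (φ.comp ψ))).subgroupOf (F.aut E)) =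
      label M T ((autVia (Q.subtype.comp ψ)).subgroupOf (F.aut E)) := by
  have hlt : image ψ < Q := (image_le ψ).lt_of_ne fun h => hQ (h ▸ conj_image hψ)
  have isPGroup : ∀ χ ∈ F.hom E Q,
      IsPGroup p ((autVia (Q.subtype.comp χ)).subgroupOf (F.aut E)) := fun χ hχ =>
    (isPGroup_autVia hS (ψ := Q.subtype.comp χ)
      (Q.subtype_injective.comp (F.injective hχ))).comap_subtype
  obtain ⟨y, hy, hyQ⟩ :=
    exists_mem_autVia_comp_notMem_inn hS (F.injective hψ) hlt (hE _ (conj_image hψ))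
  exact hM.label_eq (y := ⟨y, autVia_le_aut hψ (hyQ Q.subtype)⟩) (isPGroup _ (F.comp_mem hψ hφ))
    (isPGroup ψ hψ) (hyQ (Q.subtype.comp φ)) (hyQ Q.subtype) hy

theorem exists_conj_of_hasStronglyEmbedded (hS : IsPGroup p S)
    {X : (P : Subgroup S) → Set (MulAut P)} (hE : (generate X).IsCentric E) (hlt : E < ⊤)
    (hemb : HasStronglyEmbedded p (Out ((generate X).aut E))) :
    ∃ Q, (X Q).Nonempty ∧ (generate X).Conj E Q := by
  set F := generate X
  by_contra! hX
  obtain ⟨T, hT⟩ := ((isPGroup_autS hS E).comap_subtype (K := F.aut E)).exists_le_sylow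
  obtain ⟨-, M, hM, hMc⟩ := (hasStronglyEmbedded_quotient_iff
    (le_trans (Subgroup.comap_mono (inn_le_autS E)) hT)).mp hemb
  have hle : F ≤ F.preserving (fun χ => label M T ((autVia χ).subgroupOf (F.aut E)))
      fun g χ => by rw [autVia_conj_comp] := by
    refine generate_le_iff.mpr fun Q a ha => ?_
    have haF : a ∈ F.aut Q := generate_le_iff.mp le_rfl Q a ha
    exact ⟨haF, fun ψ hψ => label_autVia_comp_eq hS hE hMc (hX Q ⟨a, ha⟩) hψ haF⟩
  obtain ⟨y, hyS, hy⟩ := SetLike.not_le_iff_exists.mp (autS_not_le_inn hS hE.isCentricIn hlt)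
  refine hM (Subgroup.eq_top_iff' M |>.mpr fun a => ?_)
  have ha : a ∈ label M T ((autVia (E.subtype.comp a.1.toMonoidHom)).subgroupOf (F.aut E)) :=
    mem_label_of_conj_mem fun b hb =>
      hT ((autS_eq_autVia E).ge (conj_mem_autVia_of_mem_autVia_comp hb))
  have hlabel : label M T ((autVia (E.subtype.comp a.1.toMonoidHom)).subgroupOf (F.aut E)) =
      label M T ((autVia E.subtype).subgroupOf (F.aut E)) := by
    simpa only [MonoidHom.comp_id] using (hle E E a.2).2 _ (F.refl_mem E)
  exact hMc.mem_of_mem_label (y := ⟨y, autS_le_aut E hyS⟩) (autS_eq_autVia E ▸ hT)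
    (autS_eq_autVia E ▸ hyS) hy (hlabel.subset ha)

end StronglyEmbedded

end FusionSystem

namespace FusionDatum

variable {S : Type*} [Group S] [Finite S] {p : ℕ} [Fact p.Prime] {D : FusionDatum S}

theorem IsAutomizerSeq.isEssential (hS : IsPGroup p S) (hD : D.IsAutomizerSeq p) {Q : Subgroup S}
    (hQ : Q ∈ D.seq) (hlt : Q < ⊤) : D.fusionSystem.IsEssential p Q where
  lt_top := hlt
  centric := hD.isCentric Q hQ
  fullyNormalized := by
    have hQA : D.fusionSystem.IsFullyAutomized p Q := by
      rw [FusionSystem.IsFullyAutomized, ← hD.A_eq Q hQ]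
      exact hD.sylow Q hQ
    exact hQA.isFullyNormalized hS (hD.isCentric Q hQ)
  stronglyEmbedded := hD.A_eq Q hQ ▸ hD.stronglyEmbedded Q hQ hlt.ne

theorem IsAutomizerSeq.isAlperinSeq (hS : IsPGroup p S) (hD : D.IsAutomizerSeq p) :
    D.IsAlperinSeq p D.fusionSystem where
  essential_or_top Q hQ :=
    (lt_or_eq_of_le le_top).imp_left (hD.isEssential hS hQ)
  exists_rep E hE := by
    obtain ⟨Q, ⟨a, hQ, -⟩, hEQ⟩ := FusionSystem.exists_conj_of_hasStronglyEmbedded hS hE.centric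
      hE.lt_top hE.stronglyEmbedded
    refine ⟨Q, hQ, hD.isEssential hS hQ (lt_top_iff_ne_top.mpr ?_), hEQ⟩
    rintro rfl
    exact hE.lt_top.ne hEQ.symm.eq_top
  A_eq := hD.A_eq

end FusionDatum

namespace FusionSystem

variable {S : Type*} [Group S] {F G : FusionSystem S} {P Q R : Subgroup S}

theorem mem_extControl {α : P ≃* Q} {g : S} (hg : g ∈ Subgroup.normalizer (P : Set S))
    (h : MulAut.congr α (P.normalizerMonoidHom ⟨g, hg⟩) ∈ autS Q) : g ∈ extControl α :=
  ⟨⟨g, hg⟩, h, rfl⟩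

theorem centralizer_le_extControl (α : P ≃* Q) :
    Subgroup.centralizer (P : Set S) ≤ extControl α := by
  intro c hc
  refine mem_extControl (Subgroup.centralizer_le_normalizer _ hc) ?_
  have hker : P.normalizerMonoidHom ⟨c, Subgroup.centralizer_le_normalizer _ hc⟩ = 1 := by
    rw [← MonoidHom.mem_ker, Subgroup.normalizerMonoidHom_ker]
    exact hc
  rw [hker, map_one]
  exact one_mem _

theorem IsReceptive.isCentric (hQ : F.IsReceptive Q) (hc : IsCentricIn Q) : F.IsCentric Q := by
  intro P hP
  obtain ⟨α, hα⟩ := hP.symm.exists_iso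
  obtain ⟨β, hβ, hβα⟩ := hQ P α hα
  have exists_eq : ∀ q ∈ Q, ∃ x : P, (β (Subgroup.inclusion (le_extControl α) x) : S) = q :=
    fun q hq => ⟨α.symm ⟨q, hq⟩, by rw [hβα, MulEquiv.apply_symm_apply]⟩
  refine isCentricIn_iff.mpr fun c hcP => ?_
  have hβc : (β ⟨c, centralizer_le_extControl α hcP⟩ : S) ∈ Q := by
    refine isCentricIn_iff.mp hc (Subgroup.mem_centralizer_iff.mpr fun q hq => ?_)
    obtain ⟨x, rfl⟩ := exists_eq q hq
    rw [← Subgroup.coe_mul, ← Subgroup.coe_mul, ← map_mul, ← map_mul]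
    congr 2
    exact Subtype.ext (Subgroup.mem_centralizer_iff.mp hcP x x.2)
  obtain ⟨x, hx⟩ := exists_eq _ hβc
  have hxc : (x : S) = c := congrArg Subtype.val (F.injective hβ (Subtype.ext hx))
  exact hxc ▸ x.2

theorem hom_subset_of_iso_subset (h : ∀ R, F.iso P R ⊆ G.iso P R) : F.hom P Q ⊆ G.hom P Q := by
  intro φ hφ
  obtain ⟨e, he, hem, -⟩ := F.factor hφ
  exact mem_of_coe_eq (h _ hem) le_rfl fun x => (he x).symm

theorem iso_subset_of_aut_le {β : P ≃* Q} (hβF : β ∈ F.iso P Q) (hβG : β ∈ G.iso P Q)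
    {γ : R ≃* Q} (hγF : γ ∈ F.iso R Q) (hγG : γ ∈ G.iso R Q) (h : F.aut Q ≤ G.aut Q) :
    F.iso P R ⊆ G.iso P R := by
  intro α hα
  have haut : β.symm.trans (α.trans γ) ∈ G.iso Q Q :=
    h (iso_trans_mem (iso_symm_mem hβF) (iso_trans_mem hα hγF))
  convert iso_trans_mem hβG (iso_trans_mem haut (iso_symm_mem hγG)) using 1
  ext x
  simp

/-- Every morphism of `F` out of a subgroup of order larger than `n` belongs to `G`: the
inductive assertion in Alperin's fusion theorem. -/
def LeAbove (F G : FusionSystem S) (n : ℕ) : Prop :=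
  ∀ ⦃P Q : Subgroup S⦄, n < Nat.card P → F.hom P Q ⊆ G.hom P Q

variable [Finite S]

theorem IsReceptive.mem_of_lt_extControl (hQ : F.IsReceptive Q) (hFG : F.LeAbove G (Nat.card P))
    {α : P ≃* Q} (hα : α ∈ F.iso P Q) (hlt : P < extControl α) : α ∈ G.iso P Q := by
  obtain ⟨β, hβ, hβα⟩ := hQ P α hα
  have hcard : Nat.card P < Nat.card (extControl α) := by
    by_contra! h
    exact hlt.ne (Subgroup.eq_of_le_of_card_ge hlt.le h)
  exact mem_of_coe_eq (hFG hcard hβ) hlt.le fun x => (hβα x).symm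

theorem IsReceptive.aut_le_of_not_isCentricIn (hQ : F.IsReceptive Q)
    (hFG : F.LeAbove G (Nat.card Q)) (hc : ¬ IsCentricIn Q) : F.aut Q ≤ G.aut Q := by
  rw [isCentricIn_iff] at hc
  exact fun a ha => hQ.mem_of_lt_extControl (α := a) hFG ha
    ((le_extControl a).lt_of_not_ge fun h => hc ((centralizer_le_extControl a).trans h))

theorem IsReceptive.containsConjugators_aut (hQ : F.IsReceptive Q)
    (hFG : F.LeAbove G (Nat.card Q)) :
    ContainsConjugators ((G.aut Q).subgroupOf (F.aut Q))
      ((autS Q).subgroupOf (F.aut Q) \ (inn Q).subgroupOf (F.aut Q) : Set (F.aut Q)) := by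
  rintro ⟨a, ha⟩ ⟨_, _⟩ ⟨⟨g, rfl⟩, hg⟩ ⟨hag, -⟩
  have hgQ : (g : S) ∉ Q := fun h => hg ⟨⟨g, h⟩, MulEquiv.ext fun _ => rfl⟩
  exact hQ.mem_of_lt_extControl (α := a) hFG ha
    ((le_extControl a).lt_of_not_ge fun h => hgQ (h (mem_extControl g.2 hag)))

variable {p : ℕ} [Fact p.Prime]

theorem IsFullyAutomized.exists_iso_lt_extControl (hS : IsPGroup p S)
    (hQ : F.IsFullyAutomized p Q) (hPQ : F.Conj P Q) (hP : P < ⊤) :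
    ∃ α ∈ F.iso P Q, P < extControl α := by
  obtain ⟨α, hα⟩ := hPQ.exists_iso
  have hα' := iso_symm_mem hα
  obtain ⟨m, hm, hmT⟩ := IsSylowOf.exists_conj_mem hQ (autVia_le_aut hα')
    (isPGroup_autVia hS (ψ := P.subtype.comp α.symm.toMonoidHom)
      (P.subtype_injective.comp α.symm.injective))
  obtain ⟨g, -, hg, hgP⟩ := exists_mem_normalizer_notMem hS hP
  have hgα : MulAut.congr α (P.normalizerMonoidHom ⟨g, hg⟩) ∈
      autVia (P.subtype.comp α.symm.toMonoidHom) :=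
    ⟨g, fun x => congrArg Subtype.val (α.symm_apply_apply _)⟩
  exact ⟨α.trans m, iso_trans_mem (R := Q) hα hm, SetLike.lt_iff_le_and_exists.mpr
    ⟨le_extControl _, g, mem_extControl hg (hmT _ hgα), hgP⟩⟩

theorem exists_iso_mem_iso (hS : IsPGroup p S) (hQA : F.IsFullyAutomized p Q)
    (hQ : F.IsReceptive Q) (hFG : F.LeAbove G (Nat.card P)) (hPQ : F.Conj P Q) (hP : P < ⊤) :
    ∃ α ∈ F.iso P Q, α ∈ G.iso P Q :=
  let ⟨α, hα, hlt⟩ := hQA.exists_iso_lt_extControl hS hPQ hP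
  ⟨α, hα, hQ.mem_of_lt_extControl hFG hα hlt⟩

theorem hasStronglyEmbedded_of_not_aut_le (hS : IsPGroup p S) (hQA : F.IsFullyAutomized p Q)
    (hQ : F.IsReceptive Q) (hc : IsCentricIn Q) (hlt : Q < ⊤) (hFG : F.LeAbove G (Nat.card Q))
    (hnot : ¬ F.aut Q ≤ G.aut Q) : HasStronglyEmbedded p (Out (F.aut Q)) := by
  obtain ⟨U, hU⟩ := hQA
  have hU' : (U : Subgroup (F.aut Q)) = (autS Q).subgroupOf (F.aut Q) := by
    rw [← hU, Subgroup.subgroupOf, Subgroup.comap_map_eq_self_of_injective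
      (F.aut Q).subtype_injective]
  refine (hasStronglyEmbedded_quotient_iff (T := U)
    (hU' ▸ Subgroup.comap_mono (inn_le_autS Q))).mpr
    ⟨fun h => autS_not_le_inn hS hc hlt fun a ha => ?_, (G.aut Q).subgroupOf (F.aut Q),
      fun h => hnot (Subgroup.subgroupOf_eq_top.mp h), ?_⟩
  · rw [hU'] at h
    exact h (x := ⟨a, autS_le_aut Q ha⟩) ha
  · rw [← Sylow.coe_coe, hU']
    exact hQ.containsConjugators_aut hFG

theorem aut_le_of_leAbove (hS : IsPGroup p S)
    (hess : ∀ E, F.IsEssential p E → ∃ Q, F.Conj E Q ∧ F.aut Q ≤ G.aut Q)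
    (hQA : F.IsFullyAutomized p Q) (hQ : F.IsReceptive Q) (hlt : Q < ⊤)
    (hFG : F.LeAbove G (Nat.card Q)) : F.aut Q ≤ G.aut Q := by
  by_cases hc : IsCentricIn Q
  · by_contra hnot
    have hcF := hQ.isCentric hc
    obtain ⟨R, hQR, hR⟩ := hess Q ⟨hlt, hcF, hQA.isFullyNormalized hS hcF,
      hasStronglyEmbedded_of_not_aut_le hS hQA hQ hc hlt hFG hnot⟩
    have hRtop : R < ⊤ := lt_top_iff_ne_top.mpr fun h => hlt.ne (h ▸ hQR).symm.eq_top
    obtain ⟨α, hαF, hαG⟩ := exists_iso_mem_iso hS hQA hQ (hQR.card_eq ▸ hFG) hQR.symm hRtop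
    exact hnot (iso_subset_of_aut_le (iso_symm_mem hαF) (iso_symm_mem hαG) (iso_symm_mem hαF)
      (iso_symm_mem hαG) hR)
  · exact hQ.aut_le_of_not_isCentricIn hFG hc

theorem IsSaturated.iso_subset_of_leAbove (hS : IsPGroup p S) (hF : F.IsSaturated p)
    (htop : F.aut ⊤ ≤ G.aut ⊤)
    (hess : ∀ E, F.IsEssential p E → ∃ Q, F.Conj E Q ∧ F.aut Q ≤ G.aut Q)
    (hFG : F.LeAbove G (Nat.card P)) : F.iso P R ⊆ G.iso P R := by
  intro α hα
  have hPR := conj_of_iso hα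
  rcases eq_or_lt_of_le (le_top (a := P)) with rfl | hP
  · obtain rfl := hPR.eq_top
    exact htop hα
  have lt_top_of_conj : ∀ Q, F.Conj P Q → Q < ⊤ := fun Q hQ =>
    lt_top_iff_ne_top.mpr fun h => hP.ne (h ▸ hQ).symm.eq_top
  obtain ⟨Q, hPQ, hQA, hQ⟩ := hF P
  obtain ⟨β, hβF, hβG⟩ := exists_iso_mem_iso hS hQA hQ hFG hPQ hP
  obtain ⟨γ, hγF, hγG⟩ := exists_iso_mem_iso hS hQA hQ (hPR.card_eq ▸ hFG)
    (hPR.symm.trans hPQ) (lt_top_of_conj R hPR)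
  exact iso_subset_of_aut_le hβF hβG hγF hγG
    (aut_le_of_leAbove hS hess hQA hQ (lt_top_of_conj Q hPQ) (hPQ.card_eq ▸ hFG)) hα

/-- Alperin's fusion theorem. -/
theorem IsSaturated.le (hS : IsPGroup p S) (hF : F.IsSaturated p) (htop : F.aut ⊤ ≤ G.aut ⊤)
    (hess : ∀ E, F.IsEssential p E → ∃ Q, F.Conj E Q ∧ F.aut Q ≤ G.aut Q) : F ≤ G := by
  have hbase : F.LeAbove G (Nat.card S) := fun P _ hP =>
    absurd (Subgroup.card_le_card_group P) hP.not_ge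
  have hstep : ∀ n < Nat.card S, F.LeAbove G (n + 1) → F.LeAbove G n := by
    intro n _ hn P Q hP
    have hFG : F.LeAbove G (Nat.card P) := fun _ _ hR => hn (hR.trans_le' hP)
    exact hom_subset_of_iso_subset fun R => hF.iso_subset_of_leAbove hS htop hess hFG
  have hzero : F.LeAbove G 0 :=
    Nat.decreasingInduction (motive := fun n _ => F.LeAbove G n) hstep hbase (Nat.zero_le _)
  exact fun P Q => hzero Nat.card_pos

end FusionSystem

namespace FusionDatum

variable {S : Type*} [Group S] [Finite S] {p : ℕ} {D : FusionDatum S}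
  {F : FusionSystem S}

theorem IsAlperinSeq.isCentric (hD : D.IsAlperinSeq p F) {Q : Subgroup S} (hQ : Q ∈ D.seq) :
    F.IsCentric Q := by
  rcases hD.essential_or_top Q hQ with hess | rfl
  exacts [hess.centric, FusionSystem.isCentric_top]

theorem IsAlperinSeq.isFullyNormalized (hD : D.IsAlperinSeq p F) {Q : Subgroup S}
    (hQ : Q ∈ D.seq) : F.IsFullyNormalized Q := by
  rcases hD.essential_or_top Q hQ with hess | rfl
  exacts [hess.fullyNormalized, fun R hR => hR.eq_top ▸ le_rfl]

variable [Fact p.Prime]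

theorem IsAlperinSeq.eq_fusionSystem (hS : IsPGroup p S) (hF : F.IsSaturated p)
    (hD : D.IsAlperinSeq p F) : F = D.fusionSystem := by
  have aut_le : ∀ Q ∈ D.seq, F.aut Q ≤ D.fusionSystem.aut Q := fun Q hQ a ha =>
    FusionSystem.generate_le_iff.mp le_rfl Q a ⟨hQ, hD.A_eq Q hQ ▸ ha⟩
  refine le_antisymm ?_ (FusionSystem.generate_le_iff.mpr fun Q a ⟨hQ, ha⟩ => hD.A_eq Q hQ ▸ ha)
  refine hF.le hS (aut_le ⊤ (List.mem_of_head? D.head_eq)) fun E hE => ?_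
  obtain ⟨Q, hQ, -, hEQ⟩ := hD.exists_rep E hE
  exact ⟨Q, hEQ, aut_le Q hQ⟩

theorem IsAlperinSeq.isAutomizerSeq (hS : IsPGroup p S) (hF : F.IsSaturated p)
    (hD : D.IsAlperinSeq p F) : D.IsAutomizerSeq p := by
  obtain rfl := hD.eq_fusionSystem hS hF
  refine ⟨hD.A_eq, fun Q => hD.isCentric, fun Q hQ => ?_, fun Q hQ hne => ?_⟩
  · rw [hD.A_eq Q hQ]
    exact (hD.isFullyNormalized hQ).isFullyAutomized hS hF (hD.isCentric hQ)
  · rw [hD.A_eq Q hQ]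
    exact ((hD.essential_or_top Q hQ).resolve_right hne).stronglyEmbedded

end FusionDatum

end Fusion

theorem proposition3_general {S : Type*} [Group S] [Finite S] (p : ℕ) [Fact p.Prime]
    (hS : IsPGroup p S) (D : Fusion.FusionDatum S) :
    (D.IsAutomizerSeq p → D.IsAlperinSeq p D.fusionSystem) ∧
    ∀ F : Fusion.FusionSystem S, F.IsSaturated p → D.IsAlperinSeq p F →
      D.IsAutomizerSeq p ∧ F = D.fusionSystem :=
  ⟨fun hD => hD.isAlperinSeq hS,
    fun _ hF hD => ⟨hD.isAutomizerSeq hS hF, hD.eq_fusionSystem hS hF⟩⟩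

theorem proposition3 {S : Type*} [Group S] [Finite S] (p : ℕ) [Fact p.Prime]
    (hS : IsPGroup p S) (D : Fusion.FusionDatum S) :
    (D.IsAutomizerSeq p → D.fusionSystem.IsSaturated p →
      D.IsAlperinSeq p D.fusionSystem) ∧
    ∀ F : Fusion.FusionSystem S, F.IsSaturated p → D.IsAlperinSeq p F →
      D.IsAutomizerSeq p ∧ F = D.fusionSystem :=
  (proposition3_general p hS D).imp_left fun h hD _ => h hD
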